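/- **Theorem.** Let $p,q$ be positive integers and let $(\breve N,\breve g,\breve J)$ be a locally metallic semi-Riemannian manifold: $\breve g$ is a semi-Riemannian metric with Levi-Civita connection $\breve\nabla$, and $\breve J$ is a $(1,1)$-tensor field with $\breve J^2=p\breve J+qI$, $\breve g(\breve JX,Y)=\breve g(X,\breve JY)$ and $\breve\nabla\breve J=0$. Let $N$ be a lightlike submanifold immersed in $\breve N$, i.e. $Rad(TN)=TN\cap TN^\perp$ has constant rank $r\ge 1$, with screen distribution $S(TN)$ (a complement of $Rad(TN)$ in $TN$), screen transversal bundle $S(TN^\perp)$ (a complement of $Rad(TN)$ in $TN^\perp$) and lightlike transversal bundle $ltr(TN)$ (null, orthogonal to $S(TN)$ and to $S(TN^\perp)$), so that $$T\breve N|_N=S(TN)\oplus Rad(TN)\oplus ltr(TN)\oplus S(TN^\perp).$$ Assume that $N$ is screen transversal, i.e. $\breve J\,Rad(TN)\subset S(TN^\perp)$, and that $\breve J\,ltr(TN)\subset S(TN^\perp)$. Let $\nabla$ be the induced connection of $N$ (the $TN$-component of $\breve\nabla$ on vector fields of $N$). For $W,U\in\Gamma(TN)$ and a section $V$ of $T\breve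 N|_N$ let $h^s(W,U)$ and $\nabla^s_WV$ be the $S(TN^\perp)$-components of $\breve\nabla_WU$ and $\breve\nabla_WV$. Then $S(TN)$ defines a totally geodesic foliation (it is integrable, and $\nabla_WU\in\Gamma(S(TN))$ for all $W,U\in\Gamma(S(TN))$) if and only if, for all $W,U\in\Gamma(S(TN))$, the field $\nabla^s_W\breve JU-p\,h^s(W,U)$ has no component in $\breve J\,ltr(TN)$, in the sense that $$\breve g\bigl(\nabla^s_W\breve JU-p\,h^s(W,U),\ \breve JL\bigr)=0\qquad\text{for all } L\in\Gamma(ltr(TN)).$$ -/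

import Mathlib

open scoped Manifold ContDiff Topology

noncomputable section

namespace Lightlike

section Ambient

variable {E : Type*} [NormedAddCommGroup E] [NormedSpace ℝ E]
  {M : Type*} [TopologicalSpace M] [ChartedSpace E M] [IsManifold 𝓘(ℝ, E) ∞ M]

/-- A semi-Riemannian metric: a smooth field of symmetric nondegenerate bilinear forms on the
tangent spaces of `M`. -/
structure SemiRiemannianMetric (E : Type*) [NormedAddCommGroup E] [NormedSpace ℝ E]
    (M : Type*) [TopologicalSpace M] [ChartedSpace E M] [IsManifold 𝓘(ℝ, E) ∞ M] where
  /-- The scalar product on each tangent space. -/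
  val (y : M) : TangentSpace 𝓘(ℝ, E) y →L[ℝ] TangentSpace 𝓘(ℝ, E) y →L[ℝ] ℝ
  symm (y : M) (v w : TangentSpace 𝓘(ℝ, E) y) : val y v w = val y w v
  nondegenerate (y : M) (v : TangentSpace 𝓘(ℝ, E) y) (hv : ∀ w, val y v w = 0) : v = 0
  contMDiff : ContMDiff 𝓘(ℝ, E) (𝓘(ℝ, E).prod 𝓘(ℝ, E →L[ℝ] E →L[ℝ] ℝ)) ∞
    (fun y ↦ Bundle.TotalSpace.mk' (E →L[ℝ] E →L[ℝ] ℝ)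
      (E := fun y : M ↦ TangentSpace 𝓘(ℝ, E) y →L[ℝ] TangentSpace 𝓘(ℝ, E) y →L[ℝ] ℝ) y (val y))

/-- `nabla` is the Levi-Civita connection of `g`: it is torsion free, and it is compatible with `g`,
that is `X g(Y, Z) = g(∇_X Y, Z) + g(Y, ∇_X Z)`. Note that `nabla Y y v` stands for `(∇_v Y)(y)`. -/
structure IsLeviCivita [FiniteDimensional ℝ E] (g : SemiRiemannianMetric E M)
    (nabla : CovariantDerivative 𝓘(ℝ, E) E (TangentSpace 𝓘(ℝ, E) : M → Type _)) : Prop where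
  torsion_eq_zero : nabla.torsion = 0
  metric {y : M} {Y Z : Π y : M, TangentSpace 𝓘(ℝ, E) y}
    (hY : MDifferentiableAt 𝓘(ℝ, E) 𝓘(ℝ, E).tangent
      (fun y ↦ (⟨y, Y y⟩ : TangentBundle 𝓘(ℝ, E) M)) y)
    (hZ : MDifferentiableAt 𝓘(ℝ, E) 𝓘(ℝ, E).tangent
      (fun y ↦ (⟨y, Z y⟩ : TangentBundle 𝓘(ℝ, E) M)) y)
    (v : TangentSpace 𝓘(ℝ, E) y) :
    mvfderiv 𝓘(ℝ, E) (fun y ↦ g.val y (Y y) (Z y)) y v =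
      g.val y (nabla Y y v) (Z y) + g.val y (Y y) (nabla Z y v)

/-- A metallic structure with parameters `p`, `q` compatible with `g`: a smooth field `J` of
endomorphisms of the tangent spaces with `J² = p J + q I` and `g(J v, w) = g(v, J w)`, where `p` and
`q` are positive integers. A manifold with such `g` and `J` is a metallic semi-Riemannian
manifold. -/
structure MetallicStructure (g : SemiRiemannianMetric E M) (p q : ℕ) where
  /-- The endomorphism of each tangent space. -/
  J (y : M) : TangentSpace 𝓘(ℝ, E) y →L[ℝ] TangentSpace 𝓘(ℝ, E) y
  contMDiff : ContMDiff 𝓘(ℝ, E) (𝓘(ℝ, E).prod 𝓘(ℝ, E →L[ℝ] E)) ∞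
    (fun y ↦ Bundle.TotalSpace.mk' (E →L[ℝ] E)
      (E := fun y : M ↦ TangentSpace 𝓘(ℝ, E) y →L[ℝ] TangentSpace 𝓘(ℝ, E) y) y (J y))
  p_pos : 0 < p
  q_pos : 0 < q
  sq (y : M) (v : TangentSpace 𝓘(ℝ, E) y) : J y (J y v) = (p : ℝ) • J y v + (q : ℝ) • v
  compatible (y : M) (v w : TangentSpace 𝓘(ℝ, E) y) : g.val y (J y v) w = g.val y v (J y w)

/-- The structure `J` is parallel with respect to `nabla`: `∇_v (J Y) = J (∇_v Y)`.
A metallic structure which is parallel for the Levi-Civita connection is *locally metallic*. -/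
def MetallicStructure.IsParallel {g : SemiRiemannianMetric E M} {p q : ℕ}
    (S : MetallicStructure g p q)
    (nabla : CovariantDerivative 𝓘(ℝ, E) E (TangentSpace 𝓘(ℝ, E) : M → Type _)) : Prop :=
  ∀ (y : M) (Y : Π y : M, TangentSpace 𝓘(ℝ, E) y),
    MDifferentiableAt 𝓘(ℝ, E) 𝓘(ℝ, E).tangent
      (fun y ↦ (⟨y, Y y⟩ : TangentBundle 𝓘(ℝ, E) M)) y →
    ∀ v : TangentSpace 𝓘(ℝ, E) y, nabla (fun y ↦ S.J y (Y y)) y v = S.J y (nabla Y y v)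

end Ambient

section Along

variable {E : Type*} [NormedAddCommGroup E] [NormedSpace ℝ E]
  {M : Type*} [TopologicalSpace M] [ChartedSpace E M] [IsManifold 𝓘(ℝ, E) ∞ M]
  {E' : Type*} [NormedAddCommGroup E'] [NormedSpace ℝ E']
  {N : Type*} [TopologicalSpace N] [ChartedSpace E' N] [IsManifold 𝓘(ℝ, E') ∞ N]

/-- The derivative at `x`, in the direction `w`, of the vector field `V` along the map `f : N → M`,
for the pull-back by `f` of the connection `nabla` of `M`.

In the trivialization of the tangent bundle of `M` around `f x` write `V = ∑ Vⁱ eᵢ ∘ f` with `eᵢ`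
the constant fields of the trivialization. Then
`∇_w V = ∑ (∂_w Vⁱ) eᵢ + ∇_{df(w)} (∑ Vⁱ(x) eᵢ)`, where the second sum has constant
coefficients. -/
def covAlong (nabla : CovariantDerivative 𝓘(ℝ, E) E (TangentSpace 𝓘(ℝ, E) : M → Type _))
    (f : N → M) (V : Π x : N, TangentSpace 𝓘(ℝ, E) (f x)) (x : N)
    (w : TangentSpace 𝓘(ℝ, E') x) : TangentSpace 𝓘(ℝ, E) (f x) :=
  (trivializationAt E (TangentSpace 𝓘(ℝ, E)) (f x)).symmL ℝ (f x)
      (mvfderiv 𝓘(ℝ, E') (fun x' : N ↦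
        (trivializationAt E (TangentSpace 𝓘(ℝ, E)) (f x)).continuousLinearMapAt ℝ (f x') (V x'))
        x w)
    + nabla (fun y : M ↦ (trivializationAt E (TangentSpace 𝓘(ℝ, E)) (f x)).symmL ℝ y
        ((trivializationAt E (TangentSpace 𝓘(ℝ, E)) (f x)).continuousLinearMapAt ℝ (f x) (V x)))
        (f x) (mfderiv 𝓘(ℝ, E') 𝓘(ℝ, E) f x w)

/-- A family `F x` of subspaces of `T_{f x} M`, `x ∈ N`, is a smooth vector subbundle of `f^* TM`:
it has locally a smooth frame. (For `f = id` this is a smooth distribution on `M`.) -/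
def IsSmoothSubbundleAlong (f : N → M) (F : ∀ x : N, Submodule ℝ (TangentSpace 𝓘(ℝ, E) (f x))) :
    Prop :=
  ∃ k : ℕ, ∀ x₀ : N, ∃ U ∈ 𝓝 x₀, ∃ s : Fin k → Π x : N, TangentSpace 𝓘(ℝ, E) (f x),
    (∀ i, ContMDiffOn 𝓘(ℝ, E') 𝓘(ℝ, E).tangent ∞
      (fun x ↦ (⟨f x, s i x⟩ : TangentBundle 𝓘(ℝ, E) M)) U) ∧
    ∀ x ∈ U, LinearIndependent ℝ (fun i ↦ s i x) ∧
      Submodule.span ℝ (Set.range fun i ↦ s i x) = F x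

/-- `f` is a smooth immersion of the manifold `N` in the manifold `M`. -/
structure IsSmoothImmersion (f : N → M) : Prop where
  contMDiff : ContMDiff 𝓘(ℝ, E') 𝓘(ℝ, E) ∞ f
  injective (x : N) : Function.Injective (mfderiv 𝓘(ℝ, E') 𝓘(ℝ, E) f x)

/-- The image of `T_x N` in `T_{f x} M`. -/
def tangent (f : N → M) (x : N) : Submodule ℝ (TangentSpace 𝓘(ℝ, E) (f x)) :=
  LinearMap.range (mfderiv 𝓘(ℝ, E') 𝓘(ℝ, E) f x).toLinearMap

/-- The space `T_x N^⊥` of the vectors of `T_{f x} M` that are `g`-orthogonal to `T_x N`. -/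
def normal (g : SemiRiemannianMetric E M) (f : N → M) (x : N) :
    Submodule ℝ (TangentSpace 𝓘(ℝ, E) (f x)) where
  carrier := {u | ∀ v ∈ tangent (E := E) (E' := E') f x, g.val (f x) u v = 0}
  add_mem' ha hb v hv := by simp [ha v hv, hb v hv]
  zero_mem' v _ := by simp
  smul_mem' c u hu v hv := by simp [hu v hv]

/-- The radical `Rad(T_x N) = T_x N ∩ T_x N^⊥`, as a subspace of `T_x N`. -/
def radical (g : SemiRiemannianMetric E M) (f : N → M) (x : N) :
    Submodule ℝ (TangentSpace 𝓘(ℝ, E') x) :=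
  (normal (E' := E') g f x).comap (mfderiv 𝓘(ℝ, E') 𝓘(ℝ, E) f x).toLinearMap

/-- A lightlike submanifold `(N, g, S(TN), S(TN^⊥))` immersed by `f` in the semi-Riemannian manifold
`(M, g)`, together with a lightlike transversal bundle `ltr(TN)`. -/
structure LightlikeSubmanifold (g : SemiRiemannianMetric E M) (f : N → M) where
  immersion : IsSmoothImmersion (E := E) (E' := E') f
  /-- The rank of the radical distribution. -/
  r : ℕ
  one_le_r : 1 ≤ r
  finrank_radical (x : N) : Module.finrank ℝ (radical (E' := E') g f x) = r
  /-- The screen distribution `S(TN)`, a complement of the radical distribution in `TN`. -/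
  screen (x : N) : Submodule ℝ (TangentSpace 𝓘(ℝ, E') x)
  screen_smooth : IsSmoothSubbundleAlong (E := E') (E' := E') (id : N → N) screen
  screen_isCompl (x : N) : IsCompl (screen x) (radical (E' := E') g f x)
  /-- The screen transversal bundle `S(TN^⊥)`, a complement of `Rad(TN)` in `TN^⊥`. -/
  screenTr (x : N) : Submodule ℝ (TangentSpace 𝓘(ℝ, E) (f x))
  screenTr_smooth : IsSmoothSubbundleAlong (E' := E') f screenTr
  screenTr_disjoint (x : N) : Disjoint (screenTr x)
    ((radical (E' := E') g f x).map (mfderiv 𝓘(ℝ, E') 𝓘(ℝ, E) f x).toLinearMap)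
  screenTr_sup (x : N) : screenTr x ⊔
    ((radical (E' := E') g f x).map (mfderiv 𝓘(ℝ, E') 𝓘(ℝ, E) f x).toLinearMap) =
      normal (E' := E') g f x
  /-- The lightlike transversal bundle `ltr(TN)`. -/
  ltr (x : N) : Submodule ℝ (TangentSpace 𝓘(ℝ, E) (f x))
  ltr_smooth : IsSmoothSubbundleAlong (E' := E') f ltr
  ltr_null (x : N) : ∀ u ∈ ltr x, ∀ v ∈ ltr x, g.val (f x) u v = 0
  ltr_orthogonal_screen (x : N) : ∀ u ∈ ltr x, ∀ v ∈ screen x,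
    g.val (f x) u (mfderiv 𝓘(ℝ, E') 𝓘(ℝ, E) f x v) = 0
  ltr_orthogonal_screenTr (x : N) : ∀ u ∈ ltr x, ∀ v ∈ screenTr x, g.val (f x) u v = 0
  ltr_disjoint_screenTr (x : N) : Disjoint (ltr x) (screenTr x)
  /-- `TM|_N = TN ⊕ tr(TN)`, where `tr(TN) = ltr(TN) ⊕ S(TN^⊥)`. -/
  tangent_isCompl (x : N) : IsCompl (tangent (E' := E') f x) (ltr x ⊔ screenTr x)

namespace LightlikeSubmanifold

variable {g : SemiRiemannianMetric E M} {f : N → M}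

lemma screenTr_isCompl (D : LightlikeSubmanifold (E' := E') g f) (x : N) :
    IsCompl (D.screenTr x) (tangent (E' := E') f x ⊔ D.ltr x) := by
  refine ⟨?_, ?_⟩
  · have h := (D.ltr_disjoint_screenTr x).disjoint_sup_left_of_disjoint_sup_right
      (D.tangent_isCompl x).disjoint
    exact h.symm
  · rw [codisjoint_iff]
    have := (D.tangent_isCompl x).sup_eq_top
    rw [← this, sup_comm, sup_assoc]

/-- The component in `TN` of a vector of `TM|_N = TN ⊕ tr(TN)`. -/
def tangentPart (D : LightlikeSubmanifold (E' := E') g f) (x : N)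
    (v : TangentSpace 𝓘(ℝ, E) (f x)) : TangentSpace 𝓘(ℝ, E') x :=
  (LinearEquiv.ofInjective (mfderiv 𝓘(ℝ, E') 𝓘(ℝ, E) f x).toLinearMap
    (D.immersion.injective x)).symm (Submodule.projectionOnto _ _ (D.tangent_isCompl x) v)

/-- The component in `S(TN^⊥)` of a vector of `TM|_N = TN ⊕ ltr(TN) ⊕ S(TN^⊥)`. -/
def screenTrPart (D : LightlikeSubmanifold (E' := E') g f) (x : N)
    (v : TangentSpace 𝓘(ℝ, E) (f x)) : TangentSpace 𝓘(ℝ, E) (f x) :=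
  Submodule.projection _ _ (D.screenTr_isCompl x) v

/-- A vector field on `N`, as a vector field along `f`. -/
def push (_D : LightlikeSubmanifold (E' := E') g f) (U : Π x : N, TangentSpace 𝓘(ℝ, E') x) (x : N) :
    TangentSpace 𝓘(ℝ, E) (f x) :=
  mfderiv 𝓘(ℝ, E') 𝓘(ℝ, E) f x (U x)

/-- The induced connection `∇_W U` of `N`: the component of the ambient derivative in `TN`. -/
def inducedConnection (D : LightlikeSubmanifold (E' := E') g f)
    (nabla : CovariantDerivative 𝓘(ℝ, E) E (TangentSpace 𝓘(ℝ, E) : M → Type _))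
    (W U : Π x : N, TangentSpace 𝓘(ℝ, E') x) (x : N) : TangentSpace 𝓘(ℝ, E') x :=
  D.tangentPart x (covAlong nabla f (D.push U) x (W x))

/-- The screen second fundamental form `h^s(W, U)`: the component in `S(TN^⊥)` of the ambient
derivative of the tangent field `U`. -/
def hs (D : LightlikeSubmanifold (E' := E') g f)
    (nabla : CovariantDerivative 𝓘(ℝ, E) E (TangentSpace 𝓘(ℝ, E) : M → Type _))
    (W U : Π x : N, TangentSpace 𝓘(ℝ, E') x) (x : N) : TangentSpace 𝓘(ℝ, E) (f x) :=
  D.screenTrPart x (covAlong nabla f (D.push U) x (W x))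

/-- `∇^s_W V`: the component in `S(TN^⊥)` of the ambient derivative of the field `V` along `f`.
For sections `V` of `S(TN^⊥)` this is the linear connection `∇^s` of `S(TN^⊥)`. -/
def nablaS (D : LightlikeSubmanifold (E' := E') g f)
    (nabla : CovariantDerivative 𝓘(ℝ, E) E (TangentSpace 𝓘(ℝ, E) : M → Type _))
    (W : Π x : N, TangentSpace 𝓘(ℝ, E') x) (V : Π x : N, TangentSpace 𝓘(ℝ, E) (f x)) (x : N) :
    TangentSpace 𝓘(ℝ, E) (f x) :=
  D.screenTrPart x (covAlong nabla f V x (W x))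

/-- `U ∈ Γ(S(TN))`: a smooth vector field on `N` with values in the screen distribution. -/
structure IsScreenSection (D : LightlikeSubmanifold (E' := E') g f)
    (U : Π x : N, TangentSpace 𝓘(ℝ, E') x) : Prop where
  contMDiff : ContMDiff 𝓘(ℝ, E') 𝓘(ℝ, E').tangent ∞
    (fun x ↦ (⟨x, U x⟩ : TangentBundle 𝓘(ℝ, E') N))
  mem (x : N) : U x ∈ D.screen x

/-- The screen distribution defines a totally geodesic foliation: it is integrable (involutive),
and its leaves are totally geodesic for the induced connection, that is `∇_W U ∈ Γ(S(TN))` for all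
`W, U ∈ Γ(S(TN))`. -/
structure ScreenIsTotallyGeodesicFoliation (D : LightlikeSubmanifold (E' := E') g f)
    (nabla : CovariantDerivative 𝓘(ℝ, E) E (TangentSpace 𝓘(ℝ, E) : M → Type _)) : Prop where
  integrable (W U : Π x : N, TangentSpace 𝓘(ℝ, E') x) (hW : D.IsScreenSection W)
    (hU : D.IsScreenSection U) (x : N) : VectorField.mlieBracket 𝓘(ℝ, E') W U x ∈ D.screen x
  totallyGeodesic (W U : Π x : N, TangentSpace 𝓘(ℝ, E') x) (hW : D.IsScreenSection W)
    (hU : D.IsScreenSection U) (x : N) : D.inducedConnection nabla W U x ∈ D.screen x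

/-- `N` is a screen transversal lightlike submanifold: `J Rad(TN) ⊆ S(TN^⊥)`. -/
def IsScreenTransversal {p q : ℕ} (D : LightlikeSubmanifold (E' := E') g f)
    (S : MetallicStructure g p q) : Prop :=
  ∀ x : N, ∀ v ∈ radical (E' := E') g f x,
    S.J (f x) (mfderiv 𝓘(ℝ, E') 𝓘(ℝ, E) f x v) ∈ D.screenTr x

end LightlikeSubmanifold

/-- The vector `v` has no component in the subspace `F`, measured by the scalar product:
`g(v, u) = 0` for all `u ∈ F`. -/
def HasNoComponentIn (g : SemiRiemannianMetric E M) {y : M} (v : TangentSpace 𝓘(ℝ, E) y)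
    (F : Submodule ℝ (TangentSpace 𝓘(ℝ, E) y)) : Prop :=
  ∀ u ∈ F, g.val y v u = 0

end Along

end Lightlike

end

open Lightlike

namespace Lightlike

/-! Write `v` for the ambient derivative of a screen field `U` in the direction `W`. Since `J` is
parallel, the derivative of `J U` is `J v`, so the claim becomes pointwise linear algebra in `v`.
For `l` in `ltr(TN)` the vector `J l` lies in `S(TN^⊥)`, which is orthogonal to `TN` and to
`ltr(TN)`; projecting to `S(TN^⊥)` therefore does not change pairings with `J l`. Self-adjointness
and `J² - p J = q` give `g(J v - p v, J l) = g(J² v - p J v, l) = q g(v, l)`, and only the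
`TN`-component of `v` contributes to `g(v, l)`. As `q ≠ 0`, and as the screen is exactly the part of
`TN` orthogonal to `ltr(TN)` (`mem_screen_iff`), vanishing for all `l` means that the induced
derivative lies in the screen. This is `hasNoComponentIn_iff`.

Integrability then comes for free: the induced connection is torsion free, so `[W, U] = ∇_W U - ∇_U
W` lies in the screen.

The analytic input is two facts about the pull-back connection, both checked in a chart: it commutes
with a parallel `J` (`covAlong_parallel`), and it inherits vanishing torsion
(`covAlong_mfderiv_sub`). -/

lemma chart_source_mem_nhds {E M : Type*} [TopologicalSpace E] [TopologicalSpace M]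
    [ChartedSpace E M] (y₀ : M) : (chartAt E y₀).source ∈ 𝓝 y₀ :=
  (chartAt E y₀).open_source.mem_nhds (mem_chart_source E y₀)

/-! ### Calculus of vector-valued functions on a manifold. -/

section Derivatives

variable {E : Type*} [NormedAddCommGroup E] [NormedSpace ℝ E]
  {E' : Type*} [NormedAddCommGroup E'] [NormedSpace ℝ E']
  {N : Type*} [TopologicalSpace N] [ChartedSpace E' N]

lemma mvfderiv_congr {F G : N → E} {x : N} (h : F =ᶠ[𝓝 x] G) :
    mvfderiv 𝓘(ℝ, E') F x = mvfderiv 𝓘(ℝ, E') G x := by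
  unfold mvfderiv
  rw [h.mfderiv_eq]
  rfl

/-- The product rule, needed with `A` the matrix of `J` in a trivialization and `F` the coefficients
of a vector field. -/
lemma mvfderiv_clm_apply {A : N → E →L[ℝ] E} {F : N → E} {x : N}
    (hA : MDifferentiableAt 𝓘(ℝ, E') 𝓘(ℝ, E →L[ℝ] E) A x)
    (hF : MDifferentiableAt 𝓘(ℝ, E') 𝓘(ℝ, E) F x) (w : TangentSpace 𝓘(ℝ, E') x) :
    mvfderiv 𝓘(ℝ, E') (fun x' ↦ A x' (F x')) x w =
      mvfderiv 𝓘(ℝ, E') A x w (F x) + A x (mvfderiv 𝓘(ℝ, E') F x w) := by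
  rw [(hA.clm_apply hF).mvfderiv, hA.mvfderiv, hF.mvfderiv]
  have h := fderivWithin_clm_apply (𝕜 := ℝ)
    (𝓘(ℝ, E').uniqueDiffOn.uniqueDiffWithinAt (Set.mem_range_self _))
    ((mdifferentiableAt_iff _ _).1 hA).2 ((mdifferentiableAt_iff _ _).1 hF).2
  have h' := DFunLike.congr_fun h w
  simp [writtenInExtChartAt] at h' ⊢
  rw [add_comm]
  exact h'

end Derivatives

/-! ### Vector fields and connections in the coordinates of a chart. -/

section Coordinates

variable {E : Type*} [NormedAddCommGroup E] [NormedSpace ℝ E]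
  {M : Type*} [TopologicalSpace M] [ChartedSpace E M] [IsManifold 𝓘(ℝ, E) ∞ M]
  {E' : Type*} [NormedAddCommGroup E'] [NormedSpace ℝ E']
  {N : Type*} [TopologicalSpace N] [ChartedSpace E' N]

/-- The coordinates, in the trivialization around `y₀`, of tangent vectors at `y`. -/
noncomputable abbrev coord (y₀ y : M) : TangentSpace 𝓘(ℝ, E) y →L[ℝ] E :=
  (trivializationAt E (TangentSpace 𝓘(ℝ, E)) y₀).continuousLinearMapAt ℝ y

/-- The tangent vector at `y` with given coordinates in the trivialization around `y₀`. -/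
noncomputable abbrev lift (y₀ y : M) : E →L[ℝ] TangentSpace 𝓘(ℝ, E) y :=
  (trivializationAt E (TangentSpace 𝓘(ℝ, E)) y₀).symmL ℝ y

lemma lift_coord {y₀ y : M} (hy : y ∈ (chartAt E y₀).source) (v : TangentSpace 𝓘(ℝ, E) y) :
    lift y₀ y (coord y₀ y v) = v :=
  (trivializationAt E (TangentSpace 𝓘(ℝ, E)) y₀).symmL_continuousLinearMapAt (R := ℝ) hy v

lemma coord_lift {y₀ y : M} (hy : y ∈ (chartAt E y₀).source) (a : E) :
    coord y₀ y (lift y₀ y a) = a :=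
  (trivializationAt E (TangentSpace 𝓘(ℝ, E)) y₀).continuousLinearMapAt_symmL (R := ℝ) hy a

/-- Differentiability of a field along `f` is differentiability of its coordinates. -/
lemma mdifferentiableAt_along_iff {f : N → M} {x₀ : N}
    (hf : MDifferentiableAt 𝓘(ℝ, E') 𝓘(ℝ, E) f x₀) (V : Π x : N, TangentSpace 𝓘(ℝ, E) (f x)) :
    MDifferentiableAt 𝓘(ℝ, E') 𝓘(ℝ, E).tangent
      (fun x ↦ (⟨f x, V x⟩ : TangentBundle 𝓘(ℝ, E) M)) x₀ ↔
    MDifferentiableAt 𝓘(ℝ, E') 𝓘(ℝ, E) (fun x ↦ coord (f x₀) (f x) (V x)) x₀ := by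
  have h : (fun x ↦ coord (f x₀) (f x) (V x)) =ᶠ[𝓝 x₀]
      fun x ↦ (trivializationAt E (TangentSpace 𝓘(ℝ, E)) (f x₀)
        (⟨f x, V x⟩ : TangentBundle 𝓘(ℝ, E) M)).2 := by
    filter_upwards [hf.continuousAt (chart_source_mem_nhds (E := E) (f x₀))] with x hx
    exact Bundle.Trivialization.continuousLinearMapAt_apply_of_mem (R := ℝ) _ hx _
  rw [h.mdifferentiableAt_iff, mdifferentiableAt_totalSpace]
  exact and_iff_right hf

lemma mdifferentiableAt_section_iff_coord {y₀ : M} (σ : Π y : M, TangentSpace 𝓘(ℝ, E) y) :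
    MDifferentiableAt 𝓘(ℝ, E) 𝓘(ℝ, E).tangent
      (fun y ↦ (⟨y, σ y⟩ : TangentBundle 𝓘(ℝ, E) M)) y₀ ↔
    MDifferentiableAt 𝓘(ℝ, E) 𝓘(ℝ, E) (fun y ↦ coord y₀ y (σ y)) y₀ :=
  mdifferentiableAt_along_iff (f := id) mdifferentiableAt_id σ

lemma coord_lift_eventuallyEq (y₀ : M) (F : M → E) :
    (fun y ↦ coord y₀ y (lift y₀ y (F y))) =ᶠ[𝓝 y₀] F := by
  filter_upwards [chart_source_mem_nhds (E := E) y₀] with y hy using coord_lift hy _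

/-- With `F` constant this supplies the constant-coefficient fields on which torsion and parallelism
are later tested. -/
lemma mdifferentiableAt_lift {y₀ : M} {F : M → E}
    (hF : MDifferentiableAt 𝓘(ℝ, E) 𝓘(ℝ, E) F y₀) :
    MDifferentiableAt 𝓘(ℝ, E) 𝓘(ℝ, E).tangent
      (fun y ↦ (⟨y, lift y₀ y (F y)⟩ : TangentBundle 𝓘(ℝ, E) M)) y₀ := by
  rw [mdifferentiableAt_section_iff_coord, (coord_lift_eventuallyEq y₀ F).mdifferentiableAt_iff]
  exact hF

/-- The difference of a connection and of the flat connection of a chart is tensorial. -/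
lemma tensorialAt_sub_flat
    (nabla : CovariantDerivative 𝓘(ℝ, E) E (TangentSpace 𝓘(ℝ, E) : M → Type _)) (y₀ : M)
    (v : TangentSpace 𝓘(ℝ, E) y₀) :
    TensorialAt 𝓘(ℝ, E) E (fun σ : Π y : M, TangentSpace 𝓘(ℝ, E) y ↦
      nabla σ y₀ v - lift y₀ y₀ (mvfderiv 𝓘(ℝ, E) (fun y ↦ coord y₀ y (σ y)) y₀ v)) y₀ where
  smul {h σ} hh hσ := by
    -- Both connections obey the Leibniz rule with the same term `dh(v) σ(y₀)`, which cancels in the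
    -- difference.
    have h1 := nabla.isCovariantDerivativeOnUniv.leibniz hσ hh
    have h2 : mvfderiv 𝓘(ℝ, E) (fun y ↦ coord y₀ y ((h • σ) y)) y₀ =
        h y₀ • mvfderiv 𝓘(ℝ, E) (fun y ↦ coord y₀ y (σ y)) y₀
          + (mvfderiv 𝓘(ℝ, E) h y₀).smulRight (coord y₀ y₀ (σ y₀)) := by
      rw [← mvfderiv_smul hh ((mdifferentiableAt_section_iff_coord σ).1 hσ)]
      congr 1
      ext y
      simp only [Pi.smul_apply', map_smul]
    rw [h2, h1]
    simp only [add_apply, smul_apply,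
      ContinuousLinearMap.smulRight_apply, map_add, map_smul]
    rw [lift_coord (mem_chart_source E y₀)]
    module
  add {σ τ} hσ hτ := by
    have h1 := nabla.isCovariantDerivativeOnUniv.add hσ hτ
    have h2 : mvfderiv 𝓘(ℝ, E) (fun y ↦ coord y₀ y ((σ + τ) y)) y₀ =
        mvfderiv 𝓘(ℝ, E) (fun y ↦ coord y₀ y (σ y)) y₀
          + mvfderiv 𝓘(ℝ, E) (fun y ↦ coord y₀ y (τ y)) y₀ := by
      rw [← mvfderiv_add ((mdifferentiableAt_section_iff_coord σ).1 hσ)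
        ((mdifferentiableAt_section_iff_coord τ).1 hτ)]
      congr 1
      ext y
      simp only [Pi.add_apply, map_add]
    rw [h2, h1]
    simp only [add_apply, map_add]
    module

/-- The covariant derivative of a section in the coordinates of a chart. -/
lemma nabla_eq_lift_add [FiniteDimensional ℝ E]
    (nabla : CovariantDerivative 𝓘(ℝ, E) E (TangentSpace 𝓘(ℝ, E) : M → Type _)) {y₀ : M}
    {σ : Π y : M, TangentSpace 𝓘(ℝ, E) y}
    (hσ : MDifferentiableAt 𝓘(ℝ, E) 𝓘(ℝ, E).tangent
      (fun y ↦ (⟨y, σ y⟩ : TangentBundle 𝓘(ℝ, E) M)) y₀) (v : TangentSpace 𝓘(ℝ, E) y₀) :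
    nabla σ y₀ v = lift y₀ y₀ (mvfderiv 𝓘(ℝ, E) (fun y ↦ coord y₀ y (σ y)) y₀ v)
      + nabla (fun y ↦ lift y₀ y (coord y₀ y₀ (σ y₀))) y₀ v := by
  -- A tensorial operator sees only the value at `y₀`, so `σ` may be replaced by the
  -- constant-coefficient field with the same value, whose flat derivative is zero.
  have h := (tensorialAt_sub_flat nabla y₀ v).pointwise hσ
    (mdifferentiableAt_lift (F := fun _ ↦ coord y₀ y₀ (σ y₀)) mdifferentiableAt_const)
    (lift_coord (mem_chart_source E y₀) (σ y₀)).symm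
  rw [mvfderiv_congr (coord_lift_eventuallyEq y₀ fun _ ↦ coord y₀ y₀ (σ y₀)), mvfderiv_const] at h
  simp only [zero_apply, map_zero, sub_zero] at h
  rw [← h]
  module

end Coordinates

/-! ### The Lie bracket as a commutator of derivations. -/

section LieBracket

variable {E : Type*} [NormedAddCommGroup E] [NormedSpace ℝ E]
  {E' : Type*} [NormedAddCommGroup E'] [NormedSpace ℝ E']

/-- `W (U G) - U (W G) = [W, U] G` for a vector valued function `G` on a vector space. -/
lemma fderiv_fderiv_apply_sub {G : E' → E} {W U : E' → E'} {u : E'} (hG : ContDiffAt ℝ 2 G u)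
    (hW : DifferentiableAt ℝ W u) (hU : DifferentiableAt ℝ U u) :
    fderiv ℝ (fun z ↦ fderiv ℝ G z (U z)) u (W u) - fderiv ℝ (fun z ↦ fderiv ℝ G z (W z)) u (U u) =
      fderiv ℝ G u (VectorField.lieBracket ℝ W U u) := by
  have hG' : DifferentiableAt ℝ (fderiv ℝ G) u :=
    (hG.fderiv_right (m := 1) (by norm_num)).differentiableAt one_ne_zero
  rw [fderiv_clm_apply hG' hU, fderiv_clm_apply hG' hW]
  -- The second-derivative terms cancel by symmetry; the remaining terms form the bracket.
  have hs := (hG.isSymmSndFDerivAt (by simp)) (W u) (U u)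
  simp [VectorField.lieBracket, hs]

variable {N : Type*} [TopologicalSpace N] [ChartedSpace E' N] [IsManifold 𝓘(ℝ, E') ∞ N]

/-- The point `x'` is not restricted to the centre of the chart, so the formula holds on a
neighbourhood and can be differentiated once more. -/
lemma mvfderiv_comp_extChartAt {x x' : N} (hx' : x' ∈ (chartAt E' x).source) {K : E' → E}
    (hK : DifferentiableAt ℝ K (extChartAt 𝓘(ℝ, E') x x')) (w : TangentSpace 𝓘(ℝ, E') x') :
    mvfderiv 𝓘(ℝ, E') (fun z ↦ K (extChartAt 𝓘(ℝ, E') x z)) x' w =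
      fderiv ℝ K (extChartAt 𝓘(ℝ, E') x x')
        (mfderiv 𝓘(ℝ, E') 𝓘(ℝ, E') (extChartAt 𝓘(ℝ, E') x) x' w) := by
  have h := mfderiv_comp_apply x' hK.mdifferentiableAt
    (mdifferentiableAt_extChartAt (I := 𝓘(ℝ, E')) hx') w
  rw [mfderiv_eq_fderiv] at h
  exact h

/-- `W (U G) - U (W G) = [W, U] G` for a vector valued function `G` on a manifold. -/
lemma mvfderiv_mvfderiv_apply_sub [FiniteDimensional ℝ E'] {G : N → E}
    {W U : Π x : N, TangentSpace 𝓘(ℝ, E') x} {x : N}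
    (hG : ContMDiffAt 𝓘(ℝ, E') 𝓘(ℝ, E) 2 G x)
    (hW : MDifferentiableAt 𝓘(ℝ, E') 𝓘(ℝ, E').tangent
      (fun x ↦ (⟨x, W x⟩ : TangentBundle 𝓘(ℝ, E') N)) x)
    (hU : MDifferentiableAt 𝓘(ℝ, E') 𝓘(ℝ, E').tangent
      (fun x ↦ (⟨x, U x⟩ : TangentBundle 𝓘(ℝ, E') N)) x) :
    mvfderiv 𝓘(ℝ, E') (fun z ↦ mvfderiv 𝓘(ℝ, E') G z (U z)) x (W x)
      - mvfderiv 𝓘(ℝ, E') (fun z ↦ mvfderiv 𝓘(ℝ, E') G z (W z)) x (U x) =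
      mvfderiv 𝓘(ℝ, E') G x (VectorField.mlieBracket 𝓘(ℝ, E') W U x) := by
  set φ := extChartAt 𝓘(ℝ, E') x
  let K : E' → E := G ∘ φ.symm
  have hK : ContDiffAt ℝ 2 K (φ x) := by
    have := (contMDiffAt_iff.1 hG).2
    simpa [K, contDiffWithinAt_univ] using! this
  have hGK : G =ᶠ[𝓝 x] fun z ↦ K (φ z) := by
    filter_upwards [extChartAt_source_mem_nhds (I := 𝓘(ℝ, E')) x] with z hz
    simp [K, φ.left_inv hz]
  -- `r V` is `V` read in the chart; `mlieBracket` is defined through these representatives.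
  let r (V : Π x : N, TangentSpace 𝓘(ℝ, E') x) : E' → E' :=
    VectorField.mpullbackWithin 𝓘(ℝ, E') 𝓘(ℝ, E') φ.symm V (Set.range 𝓘(ℝ, E'))
  have hr (V : Π x : N, TangentSpace 𝓘(ℝ, E') x) :
      ∀ᶠ z in 𝓝 x, mfderiv 𝓘(ℝ, E') 𝓘(ℝ, E') φ z (V z) = r V (φ z) := by
    have h := VectorField.eventuallyEq_mpullback_mpullbackWithin_extChartAt
      (I := 𝓘(ℝ, E')) (s := Set.univ) (x := x) V
    rw [nhdsWithin_univ] at h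
    filter_upwards [h, extChartAt_source_mem_nhds (I := 𝓘(ℝ, E')) x] with z hz hz'
    rw [hz, VectorField.mpullback_apply]
    exact (isInvertible_mfderiv_extChartAt hz').self_apply_inverse _
  have huniv : φ.symm ⁻¹' Set.univ ∩ Set.range 𝓘(ℝ, E') = Set.univ := by simp
  have hdiff (V : Π x : N, TangentSpace 𝓘(ℝ, E') x)
      (hV : MDifferentiableAt 𝓘(ℝ, E') 𝓘(ℝ, E').tangent
        (fun x ↦ (⟨x, V x⟩ : TangentBundle 𝓘(ℝ, E') N)) x) : DifferentiableAt ℝ (r V) (φ x) := by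
    have h := (hV.mdifferentiableWithinAt
      (s := Set.univ)).differentiableWithinAt_mpullbackWithin_vectorField
    rw [huniv] at h
    exact differentiableWithinAt_univ.1 h
  have hfirst (V : Π x : N, TangentSpace 𝓘(ℝ, E') x) :
      (fun z ↦ mvfderiv 𝓘(ℝ, E') G z (V z)) =ᶠ[𝓝 x] fun z ↦ fderiv ℝ K (φ z) (r V (φ z)) := by
    have hd : ∀ᶠ u in 𝓝 (φ x), DifferentiableAt ℝ K u := by
      filter_upwards [hK.eventually (by simp)] with u hu
      exact hu.differentiableAt two_ne_zero
    filter_upwards [hr V, chart_source_mem_nhds (E := E') x, hGK.eventually_nhds,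
      (continuousAt_extChartAt (I := 𝓘(ℝ, E')) x).eventually hd] with z hz hzs hzG hzd
    rw [mvfderiv_congr hzG, mvfderiv_comp_extChartAt hzs hzd, hz]
  have hsecond (V V' : Π x : N, TangentSpace 𝓘(ℝ, E') x)
      (hV : MDifferentiableAt 𝓘(ℝ, E') 𝓘(ℝ, E').tangent
        (fun x ↦ (⟨x, V x⟩ : TangentBundle 𝓘(ℝ, E') N)) x) :
      mvfderiv 𝓘(ℝ, E') (fun z ↦ mvfderiv 𝓘(ℝ, E') G z (V z)) x (V' x) =
        fderiv ℝ (fun u ↦ fderiv ℝ K u (r V u)) (φ x) (r V' (φ x)) := by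
    rw [mvfderiv_congr (hfirst V), ← (hr V').self_of_nhds]
    refine mvfderiv_comp_extChartAt (K := fun u ↦ fderiv ℝ K u (r V u)) (mem_chart_source E' x) ?_ _
    exact ((hK.fderiv_right (m := 1) (by norm_num)).differentiableAt one_ne_zero).clm_apply
      (hdiff V hV)
  have hbr : mfderiv 𝓘(ℝ, E') 𝓘(ℝ, E') φ x (VectorField.mlieBracket 𝓘(ℝ, E') W U x) =
      VectorField.lieBracket ℝ (r W) (r U) (φ x) := by
    rw [← VectorField.mlieBracketWithin_univ, VectorField.mlieBracketWithin_apply]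
    refine ((isInvertible_mfderiv_extChartAt (mem_extChartAt_source x)).self_apply_inverse
      _).trans ?_
    rw [← VectorField.lieBracketWithin_univ, ← huniv]
  rw [hsecond U W hU, hsecond W U hW, fderiv_fderiv_apply_sub hK (hdiff W hW) (hdiff U hU),
    mvfderiv_congr hGK, mvfderiv_comp_extChartAt (mem_chart_source E' x)
      (hK.differentiableAt two_ne_zero), hbr]

end LieBracket

/-! ### The pull-back connection: parallel endomorphisms and torsion. -/

section Along

variable {E : Type*} [NormedAddCommGroup E] [NormedSpace ℝ E] [FiniteDimensional ℝ E]
  {M : Type*} [TopologicalSpace M] [ChartedSpace E M] [IsManifold 𝓘(ℝ, E) ∞ M]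

/-- The coordinate vector fields of a chart commute. -/
lemma mlieBracket_lift_lift (y₀ : M) (a b : E) :
    VectorField.mlieBracket 𝓘(ℝ, E) (fun y ↦ lift y₀ y a) (fun y ↦ lift y₀ y b) y₀ = 0 := by
  have : IsManifold 𝓘(ℝ, E) (minSmoothness ℝ 2) M := by
    simpa using (inferInstance : IsManifold 𝓘(ℝ, E) 2 M)
  let k (c : E) : Π z : E, TangentSpace 𝓘(ℝ, E) z := fun _ ↦ c
  -- Coordinate fields are pull-backs of constant fields, whose bracket vanishes, and pull-back
  -- commutes with the bracket.
  have h (c : E) : (fun y ↦ lift y₀ y c) =ᶠ[𝓝 y₀]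
      VectorField.mpullback 𝓘(ℝ, E) 𝓘(ℝ, E) (extChartAt 𝓘(ℝ, E) y₀) (k c) := by
    filter_upwards [chart_source_mem_nhds (E := E) y₀] with y hy
    have hi := isInvertible_mfderiv_extChartAt (I := 𝓘(ℝ, E)) (x := y₀) (y := y) (by simpa using hy)
    refine ((hi.inverse_apply_eq).2 ?_).symm
    rw [← TangentBundle.continuousLinearMapAt_trivializationAt hy]
    exact (coord_lift hy c).symm
  have hk (c z : E) : MDifferentiableAt 𝓘(ℝ, E) 𝓘(ℝ, E).tangent
      (fun u ↦ (⟨u, k c u⟩ : TangentBundle 𝓘(ℝ, E) E)) z :=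
    (contMDiffAt_vectorSpace_iff_contDiffAt (n := 1) (V := k c)).2
      contDiffAt_const |>.mdifferentiableAt one_ne_zero
  have hbracket : VectorField.mlieBracket 𝓘(ℝ, E) (k a) (k b) = 0 := by
    rw [← VectorField.mlieBracketWithin_univ, VectorField.mlieBracketWithin_eq_lieBracketWithin]
    ext z
    change fderivWithin ℝ (fun _ : E ↦ b) _ z a - fderivWithin ℝ (fun _ : E ↦ a) _ z b = 0
    simp
  rw [Filter.EventuallyEq.mlieBracket_vectorField_eq (h a) (h b),
    ← VectorField.mpullback_mlieBracket (hk a _) (hk b _)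
      (contMDiffAt_extChartAt (I := 𝓘(ℝ, E)) (n := 2)) (by simp), hbracket]
  simp

variable {E' : Type*} [NormedAddCommGroup E'] [NormedSpace ℝ E']
  {N : Type*} [TopologicalSpace N] [ChartedSpace E' N]

/-- A parallel field of endomorphisms commutes with the pull-back connection along a map. -/
lemma covAlong_parallel {g : SemiRiemannianMetric E M} {p q : ℕ} (S : MetallicStructure g p q)
    {nabla : CovariantDerivative 𝓘(ℝ, E) E (TangentSpace 𝓘(ℝ, E) : M → Type _)}
    (hS : S.IsParallel nabla) {f : N → M} {x : N} (hf : MDifferentiableAt 𝓘(ℝ, E') 𝓘(ℝ, E) f x)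
    {V : Π x : N, TangentSpace 𝓘(ℝ, E) (f x)}
    (hV : MDifferentiableAt 𝓘(ℝ, E') 𝓘(ℝ, E).tangent
      (fun x ↦ (⟨f x, V x⟩ : TangentBundle 𝓘(ℝ, E) M)) x) (w : TangentSpace 𝓘(ℝ, E') x) :
    covAlong nabla f (fun x ↦ S.J (f x) (V x)) x w = S.J (f x) (covAlong nabla f V x w) := by
  set y₀ := f x with hy₀
  -- The matrix of `J` in the trivialization around `y₀`.
  let A : M → E →L[ℝ] E := fun y ↦ (coord y₀ y).comp ((S.J y).comp (lift y₀ y))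
  have hA : MDifferentiableAt 𝓘(ℝ, E) 𝓘(ℝ, E →L[ℝ] E) A y₀ :=
    ((mdifferentiableAt_hom_bundle _).1 ((S.contMDiff y₀).mdifferentiableAt (by simp))).2
  have hV' := (mdifferentiableAt_along_iff hf V).1 hV
  have hs := mem_chart_source E y₀
  set a : E := coord y₀ y₀ (V x) with ha
  have hcoord : (fun x' ↦ coord y₀ (f x') (S.J (f x') (V x'))) =ᶠ[𝓝 x]
      fun x' ↦ A (f x') (coord y₀ (f x') (V x')) := by
    filter_upwards [hf.continuousAt (chart_source_mem_nhds (E := E) y₀)] with x' hx'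
    simp only [A, ContinuousLinearMap.comp_apply]
    rw [lift_coord hx']
  have hAf : MDifferentiableAt 𝓘(ℝ, E') 𝓘(ℝ, E →L[ℝ] E) (fun x' ↦ A (f x')) x :=
    hA.comp x hf
  have hAa : MDifferentiableAt 𝓘(ℝ, E) 𝓘(ℝ, E) (fun y ↦ A y a) y₀ :=
    hA.clm_apply mdifferentiableAt_const
  have hlift := mdifferentiableAt_lift (y₀ := y₀) (F := fun _ ↦ a) mdifferentiableAt_const
  have hJlift : MDifferentiableAt 𝓘(ℝ, E) 𝓘(ℝ, E).tangent
      (fun y ↦ (⟨y, S.J y (lift y₀ y a)⟩ : TangentBundle 𝓘(ℝ, E) M)) y₀ :=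
    (mdifferentiableAt_section_iff_coord _).2 hAa
  -- Parallelism is used only for the constant-coefficient field with value `V x` at `y₀`: it
  -- expresses the derivative of `A` through the connection, which cancels the extra term of the
  -- product rule for `A (f x') (V x')`.
  have hconst := nabla_eq_lift_add nabla hJlift (mfderiv 𝓘(ℝ, E') 𝓘(ℝ, E) f x w)
  rw [hS y₀ _ hlift] at hconst
  have hcomp : mvfderiv 𝓘(ℝ, E') (fun x' ↦ A (f x')) x w a =
      mvfderiv 𝓘(ℝ, E) (fun y ↦ A y a) y₀ (mfderiv 𝓘(ℝ, E') 𝓘(ℝ, E) f x w) := by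
    have h1 := mvfderiv_clm_apply hA (F := fun _ ↦ a) mdifferentiableAt_const
      (mfderiv 𝓘(ℝ, E') 𝓘(ℝ, E) f x w)
    have h2 : mvfderiv 𝓘(ℝ, E') (fun x' ↦ A (f x')) x w =
        mvfderiv 𝓘(ℝ, E) A y₀ (mfderiv 𝓘(ℝ, E') 𝓘(ℝ, E) f x w) :=
      mfderiv_comp_apply x hA hf w
    rw [h1, h2, mvfderiv_const]
    simp
  have hval : coord y₀ y₀ (S.J y₀ (V x)) = coord y₀ y₀ (S.J y₀ (lift y₀ y₀ a)) := by
    rw [ha, lift_coord hs]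
  unfold covAlong
  rw [map_add]
  change lift y₀ y₀ (mvfderiv 𝓘(ℝ, E') (fun x' ↦ coord y₀ (f x') (S.J (f x') (V x'))) x w)
      + nabla (fun y ↦ lift y₀ y (coord y₀ y₀ (S.J y₀ (V x)))) y₀ _ =
    S.J y₀ (lift y₀ y₀ (mvfderiv 𝓘(ℝ, E') (fun x' ↦ coord y₀ (f x') (V x')) x w))
      + S.J y₀ (nabla (fun y ↦ lift y₀ y a) y₀ _)
  have hJl : S.J y₀ (lift y₀ y₀ (mvfderiv 𝓘(ℝ, E') (fun x' ↦ coord y₀ (f x') (V x')) x w)) =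
      lift y₀ y₀ (A y₀ (mvfderiv 𝓘(ℝ, E') (fun x' ↦ coord y₀ (f x') (V x')) x w)) :=
    (lift_coord hs _).symm
  rw [hconst, mvfderiv_congr hcoord, mvfderiv_clm_apply hAf hV', map_add, hJl, hval]
  change lift y₀ y₀ (mvfderiv 𝓘(ℝ, E') (fun x' ↦ A (f x')) x w a) + _ + _ = _
  rw [hcomp]
  exact (add_assoc _ _ _).trans (add_left_comm _ _ _)

variable [FiniteDimensional ℝ E'] [IsManifold 𝓘(ℝ, E') ∞ N]

/-- The pull-back along a smooth map of a torsion free connection is torsion free. -/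
lemma covAlong_mfderiv_sub
    {nabla : CovariantDerivative 𝓘(ℝ, E) E (TangentSpace 𝓘(ℝ, E) : M → Type _)}
    (hnabla : nabla.torsion = 0) {f : N → M} (hf : ContMDiff 𝓘(ℝ, E') 𝓘(ℝ, E) ∞ f)
    {W U : Π x : N, TangentSpace 𝓘(ℝ, E') x} {x : N}
    (hW : MDifferentiableAt 𝓘(ℝ, E') 𝓘(ℝ, E').tangent
      (fun x ↦ (⟨x, W x⟩ : TangentBundle 𝓘(ℝ, E') N)) x)
    (hU : MDifferentiableAt 𝓘(ℝ, E') 𝓘(ℝ, E').tangent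
      (fun x ↦ (⟨x, U x⟩ : TangentBundle 𝓘(ℝ, E') N)) x) :
    covAlong nabla f (fun x ↦ mfderiv 𝓘(ℝ, E') 𝓘(ℝ, E) f x (U x)) x (W x)
      - covAlong nabla f (fun x ↦ mfderiv 𝓘(ℝ, E') 𝓘(ℝ, E) f x (W x)) x (U x) =
      mfderiv 𝓘(ℝ, E') 𝓘(ℝ, E) f x (VectorField.mlieBracket 𝓘(ℝ, E') W U x) := by
  set y₀ := f x with hy₀
  have hs := mem_chart_source E y₀
  -- The coordinates of `df(V)` are `dG(V)`, so the flat parts contribute `W (U G) - U (W G) = dG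
  -- [W, U]`.
  let G : N → E := fun x' ↦ extChartAt 𝓘(ℝ, E) y₀ (f x')
  have hfd (x' : N) : MDifferentiableAt 𝓘(ℝ, E') 𝓘(ℝ, E) f x' :=
    (hf x').mdifferentiableAt (by simp)
  have hG : ContMDiffAt 𝓘(ℝ, E') 𝓘(ℝ, E) 2 G x :=
    (contMDiffAt_extChartAt (I := 𝓘(ℝ, E)) (n := 2)).comp x ((hf x).of_le (WithTop.coe_le_coe.2 le_top))
  have hchain {x' : N} (hx' : f x' ∈ (chartAt E y₀).source) (v : TangentSpace 𝓘(ℝ, E') x') :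
      coord y₀ (f x') (mfderiv 𝓘(ℝ, E') 𝓘(ℝ, E) f x' v) = mvfderiv 𝓘(ℝ, E') G x' v := by
    have h := mfderiv_comp_apply x' (mdifferentiableAt_extChartAt (I := 𝓘(ℝ, E)) hx') (hfd x') v
    rw [← TangentBundle.continuousLinearMapAt_trivializationAt hx'] at h
    exact h.symm
  have hcoord (V : Π x : N, TangentSpace 𝓘(ℝ, E') x) :
      (fun x' ↦ coord y₀ (f x') (mfderiv 𝓘(ℝ, E') 𝓘(ℝ, E) f x' (V x'))) =ᶠ[𝓝 x]
        fun x' ↦ mvfderiv 𝓘(ℝ, E') G x' (V x') := by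
    filter_upwards [(hfd x).continuousAt (chart_source_mem_nhds (E := E) y₀)] with x' hx'
    exact hchain hx' _
  let σ (V : Π x : N, TangentSpace 𝓘(ℝ, E') x) (y : M) : TangentSpace 𝓘(ℝ, E) y :=
    lift y₀ y (coord y₀ y₀ (mfderiv 𝓘(ℝ, E') 𝓘(ℝ, E) f x (V x)))
  have hσ (V : Π x : N, TangentSpace 𝓘(ℝ, E') x) : MDifferentiableAt 𝓘(ℝ, E) 𝓘(ℝ, E).tangent
      (fun y ↦ (⟨y, σ V y⟩ : TangentBundle 𝓘(ℝ, E) M)) y₀ :=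
    mdifferentiableAt_lift mdifferentiableAt_const
  have hσ₀ (V : Π x : N, TangentSpace 𝓘(ℝ, E') x) :
      σ V y₀ = mfderiv 𝓘(ℝ, E') 𝓘(ℝ, E) f x (V x) := lift_coord hs _
  -- The constant-coefficient extensions commute, so vanishing torsion cancels the remaining
  -- connection terms.
  have htorsion := nabla.torsion_eq_zero_iff.1 hnabla (hσ W) (hσ U)
  rw [mlieBracket_lift_lift, hσ₀, hσ₀] at htorsion
  have hcov (V V' : Π x : N, TangentSpace 𝓘(ℝ, E') x) :
      covAlong nabla f (fun x ↦ mfderiv 𝓘(ℝ, E') 𝓘(ℝ, E) f x (V x)) x (V' x) =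
        lift y₀ y₀ (mvfderiv 𝓘(ℝ, E') (fun x' ↦ mvfderiv 𝓘(ℝ, E') G x' (V x')) x (V' x))
          + nabla (σ V) y₀ (mfderiv 𝓘(ℝ, E') 𝓘(ℝ, E) f x (V' x)) := by
    rw [← mvfderiv_congr (hcoord V)]
    rfl
  have hbracket := congrArg (lift y₀ y₀) (mvfderiv_mvfderiv_apply_sub hG hW hU)
  rw [← hchain hs, lift_coord hs, map_sub] at hbracket
  rw [hcov, hcov, ← hbracket, add_sub_add_comm, htorsion, add_zero]

end Along

/-- The push-forward of a differentiable vector field is differentiable along the map. -/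
lemma mdifferentiableAt_mfderiv_apply {E : Type*} [NormedAddCommGroup E] [NormedSpace ℝ E]
    {M : Type*} [TopologicalSpace M] [ChartedSpace E M] [IsManifold 𝓘(ℝ, E) ∞ M]
    {E' : Type*} [NormedAddCommGroup E'] [NormedSpace ℝ E']
    {N : Type*} [TopologicalSpace N] [ChartedSpace E' N] [IsManifold 𝓘(ℝ, E') ∞ N]
    {f : N → M} (hf : ContMDiff 𝓘(ℝ, E') 𝓘(ℝ, E) ∞ f)
    {U : Π x : N, TangentSpace 𝓘(ℝ, E') x}
    (hU : ContMDiff 𝓘(ℝ, E') 𝓘(ℝ, E').tangent ∞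
      (fun x ↦ (⟨x, U x⟩ : TangentBundle 𝓘(ℝ, E') N))) (x : N) :
    MDifferentiableAt 𝓘(ℝ, E') 𝓘(ℝ, E).tangent
      (fun x ↦ (⟨f x, mfderiv 𝓘(ℝ, E') 𝓘(ℝ, E) f x (U x)⟩ : TangentBundle 𝓘(ℝ, E) M)) x :=
  ((hf.contMDiff_tangentMap (m := 1) (by exact WithTop.coe_le_coe.2 le_top)).mdifferentiable
    one_ne_zero _).comp x ((hU x).mdifferentiableAt (by simp))

/-! ### Pointwise linear algebra of the decomposition of `TM|_N`. -/

namespace LightlikeSubmanifold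

variable {E : Type*} [NormedAddCommGroup E] [NormedSpace ℝ E]
  {M : Type*} [TopologicalSpace M] [ChartedSpace E M] [IsManifold 𝓘(ℝ, E) ∞ M]
  {E' : Type*} [NormedAddCommGroup E'] [NormedSpace ℝ E']
  {N : Type*} [TopologicalSpace N] [ChartedSpace E' N] [IsManifold 𝓘(ℝ, E') ∞ N]
  {g : SemiRiemannianMetric E M} {f : N → M} (D : LightlikeSubmanifold (E' := E') g f)

lemma screenTr_le_normal (x : N) : D.screenTr x ≤ normal (E' := E') g f x :=
  (D.screenTr_sup x) ▸ le_sup_left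

lemma metric_screenTr_tangent {x : N} {s t : TangentSpace 𝓘(ℝ, E) (f x)} (hs : s ∈ D.screenTr x)
    (ht : t ∈ tangent (E := E) (E' := E') f x) : g.val (f x) s t = 0 :=
  D.screenTr_le_normal x hs t ht

/-- Pairing with `S(TN^⊥)` only sees the component in `S(TN^⊥)`. -/
lemma metric_screenTrPart {x : N} (v : TangentSpace 𝓘(ℝ, E) (f x))
    {s : TangentSpace 𝓘(ℝ, E) (f x)} (hs : s ∈ D.screenTr x) :
    g.val (f x) (D.screenTrPart x v) s = g.val (f x) v s := by
  have h : v - D.screenTrPart x v ∈ tangent (E := E) (E' := E') f x ⊔ D.ltr x :=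
    Submodule.sub_projection_mem (D.screenTr_isCompl x) v
  obtain ⟨t, ht, l, hl, htl⟩ := Submodule.mem_sup.1 h
  have h0 : g.val (f x) (v - D.screenTrPart x v) s = 0 := by
    rw [← htl, map_add, add_apply, D.ltr_orthogonal_screenTr x l hl s hs, g.symm,
      D.metric_screenTr_tangent hs ht, add_zero]
  rw [map_sub, sub_apply, sub_eq_zero] at h0
  exact h0.symm

/-- Pairing with `ltr(TN)` only sees the component in `TN`. -/
lemma metric_tangentPart {x : N} (v : TangentSpace 𝓘(ℝ, E) (f x))
    {l : TangentSpace 𝓘(ℝ, E) (f x)} (hl : l ∈ D.ltr x) :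
    g.val (f x) (mfderiv 𝓘(ℝ, E') 𝓘(ℝ, E) f x (D.tangentPart x v)) l = g.val (f x) v l := by
  have hp : mfderiv 𝓘(ℝ, E') 𝓘(ℝ, E) f x (D.tangentPart x v) =
      (Submodule.projectionOnto _ _ (D.tangent_isCompl x) v : TangentSpace 𝓘(ℝ, E) (f x)) :=
    congrArg Subtype.val ((LinearEquiv.ofInjective
      (mfderiv 𝓘(ℝ, E') 𝓘(ℝ, E) f x).toLinearMap (D.immersion.injective x)).apply_symm_apply
        (Submodule.projectionOnto _ _ (D.tangent_isCompl x) v))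
  have h : v - mfderiv 𝓘(ℝ, E') 𝓘(ℝ, E) f x (D.tangentPart x v) ∈ D.ltr x ⊔ D.screenTr x := by
    rw [hp]
    exact Submodule.sub_projection_mem (D.tangent_isCompl x) v
  obtain ⟨l', hl', s, hs, hls⟩ := Submodule.mem_sup.1 h
  have h0 : g.val (f x) (v - mfderiv 𝓘(ℝ, E') 𝓘(ℝ, E) f x (D.tangentPart x v)) l = 0 := by
    rw [← hls, map_add, add_apply, D.ltr_null x l' hl' l hl, g.symm _ s,
      D.ltr_orthogonal_screenTr x l hl s hs, add_zero]
  rw [map_sub, sub_apply, sub_eq_zero] at h0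
  exact h0.symm

lemma tangentPart_mfderiv {x : N} (u : TangentSpace 𝓘(ℝ, E') x) :
    D.tangentPart x (mfderiv 𝓘(ℝ, E') 𝓘(ℝ, E) f x u) = u := by
  refine (LinearEquiv.symm_apply_eq _).2 ?_
  exact Submodule.projectionOnto_apply_left (D.tangent_isCompl x)
    ⟨mfderiv 𝓘(ℝ, E') 𝓘(ℝ, E) f x u, u, rfl⟩

lemma tangentPart_sub {x : N} (v w : TangentSpace 𝓘(ℝ, E) (f x)) :
    D.tangentPart x (v - w) = D.tangentPart x v - D.tangentPart x w :=
  map_sub ((LinearEquiv.ofInjective (mfderiv 𝓘(ℝ, E') 𝓘(ℝ, E) f x).toLinearMap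
    (D.immersion.injective x)).symm.toLinearMap ∘ₗ
      Submodule.projectionOnto _ _ (D.tangent_isCompl x)) v w

/-- The screen distribution is the orthogonal complement of `ltr(TN)` in `TN`. -/
lemma mem_screen_iff {x : N} (u : TangentSpace 𝓘(ℝ, E') x) :
    u ∈ D.screen x ↔
      ∀ l ∈ D.ltr x, g.val (f x) (mfderiv 𝓘(ℝ, E') 𝓘(ℝ, E) f x u) l = 0 := by
  refine ⟨fun hu l hl ↦ by rw [g.symm, D.ltr_orthogonal_screen x l hl u hu], fun h ↦ ?_⟩
  have hu : u ∈ D.screen x ⊔ radical (E' := E') g f x := by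
    rw [(D.screen_isCompl x).sup_eq_top]
    trivial
  obtain ⟨s, hs, ρ, hρ, rfl⟩ := Submodule.mem_sup.1 hu
  have hρl (l : TangentSpace 𝓘(ℝ, E) (f x)) (hl : l ∈ D.ltr x) :
      g.val (f x) (mfderiv 𝓘(ℝ, E') 𝓘(ℝ, E) f x ρ) l = 0 := by
    have := h l hl
    rwa [map_add, map_add, add_apply, g.symm _ _ l, D.ltr_orthogonal_screen x l hl s hs,
      zero_add] at this
  -- The radical component `ρ` is orthogonal to `TN` and `S(TN^⊥)` by nature and to `ltr(TN)` by
  -- assumption, hence to everything.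
  have hρ0 : mfderiv 𝓘(ℝ, E') 𝓘(ℝ, E) f x ρ = 0 := by
    refine g.nondegenerate _ _ fun w ↦ ?_
    have hw : w ∈ tangent (E := E) (E' := E') f x ⊔ (D.ltr x ⊔ D.screenTr x) := by
      rw [(D.tangent_isCompl x).sup_eq_top]
      trivial
    obtain ⟨t, ht, n, hn, rfl⟩ := Submodule.mem_sup.1 hw
    obtain ⟨l, hl, s', hs', rfl⟩ := Submodule.mem_sup.1 hn
    have h1 : g.val (f x) (mfderiv 𝓘(ℝ, E') 𝓘(ℝ, E) f x ρ) t = 0 := hρ t ht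
    have h2 : g.val (f x) (mfderiv 𝓘(ℝ, E') 𝓘(ℝ, E) f x ρ) s' = 0 :=
      (g.symm _ _ _).trans (D.metric_screenTr_tangent hs' ⟨ρ, rfl⟩)
    rw [map_add, map_add, h1, hρl l hl, h2, add_zero, add_zero]
  have : ρ = 0 := D.immersion.injective x (by rw [hρ0, map_zero])
  rwa [this, add_zero]

/-- The component in `J ltr(TN)` of the screen transversal part of `J v - p v` vanishes if and only
if the tangential part of `v` lies in the screen distribution. -/
lemma hasNoComponentIn_iff {p q : ℕ} (S : MetallicStructure g p q)
    (hltr : ∀ x : N, ∀ v ∈ D.ltr x, S.J (f x) v ∈ D.screenTr x) {x : N}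
    (v : TangentSpace 𝓘(ℝ, E) (f x)) :
    HasNoComponentIn g (D.screenTrPart x (S.J (f x) v) - (p : ℝ) • D.screenTrPart x v)
      ((D.ltr x).map (S.J (f x)).toLinearMap) ↔ D.tangentPart x v ∈ D.screen x := by
  have key (l : TangentSpace 𝓘(ℝ, E) (f x)) (hl : l ∈ D.ltr x) :
      g.val (f x) (D.screenTrPart x (S.J (f x) v) - (p : ℝ) • D.screenTrPart x v) (S.J (f x) l) =
        q * g.val (f x) (mfderiv 𝓘(ℝ, E') 𝓘(ℝ, E) f x (D.tangentPart x v)) l := by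
    -- `hltr` lets both projections be dropped; moving `J` off `l` then leaves `J² v - p J v = q v`.
    rw [map_sub, map_smul, sub_apply, smul_apply, D.metric_screenTrPart _ (hltr x l hl),
      D.metric_screenTrPart _ (hltr x l hl), ← S.compatible, ← S.compatible, S.sq, map_add,
      map_smul, map_smul, add_apply, smul_apply, smul_apply, D.metric_tangentPart v hl]
    simp
  have hq : (q : ℝ) ≠ 0 := Nat.cast_ne_zero.2 S.q_pos.ne'
  rw [D.mem_screen_iff]
  constructor
  · intro h l hl
    have := h _ (Submodule.mem_map_of_mem hl)
    exact (mul_eq_zero.1 ((key l hl).symm.trans this)).resolve_left hq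
  · rintro h _ ⟨l, hl, rfl⟩
    exact (key l hl).trans (by rw [h l hl, mul_zero])

end LightlikeSubmanifold

end Lightlike

/-! ### Assembling the equivalence. -/

open Lightlike
theorem mainTheorem5
    {E : Type*} [NormedAddCommGroup E] [NormedSpace ℝ E] [FiniteDimensional ℝ E]
    {M : Type*} [TopologicalSpace M] [ChartedSpace E M] [IsManifold 𝓘(ℝ, E) ∞ M]
    {E' : Type*} [NormedAddCommGroup E'] [NormedSpace ℝ E'] [FiniteDimensional ℝ E']
    {N : Type*} [TopologicalSpace N] [ChartedSpace E' N] [IsManifold 𝓘(ℝ, E') ∞ N]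
    -- a locally metallic semi-Riemannian manifold, with its Levi-Civita connection
    (g : SemiRiemannianMetric E M)
    (nabla : CovariantDerivative 𝓘(ℝ, E) E (TangentSpace 𝓘(ℝ, E) : M → Type _))
    (hnabla : IsLeviCivita g nabla)
    (p q : ℕ) (S : MetallicStructure g p q) (hS : S.IsParallel nabla)
    -- a screen transversal lightlike submanifold
    (f : N → M) (D : LightlikeSubmanifold (E' := E') g f) (hD : D.IsScreenTransversal S)
    -- as in the decomposition of `S(TN^⊥)`, the bundle `J ltr(TN)` lies in `S(TN^⊥)`
    (hltr : ∀ x : N, ∀ v ∈ D.ltr x, S.J (f x) v ∈ D.screenTr x) :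
    D.ScreenIsTotallyGeodesicFoliation nabla ↔
      ∀ W U : (Π x : N, TangentSpace 𝓘(ℝ, E') x), D.IsScreenSection W → D.IsScreenSection U →
        ∀ x : N, HasNoComponentIn g
          (D.nablaS nabla W (fun x' ↦ S.J (f x') (D.push U x')) x
            - (p : ℝ) • D.hs nabla W U x)
          ((D.ltr x).map (S.J (f x)).toLinearMap) := by
  have hf := D.immersion.contMDiff
  have key (W U : Π x : N, TangentSpace 𝓘(ℝ, E') x) (hU : D.IsScreenSection U) (x : N) :
      HasNoComponentIn g
          (D.nablaS nabla W (fun x' ↦ S.J (f x') (D.push U x')) x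
            - (p : ℝ) • D.hs nabla W U x)
          ((D.ltr x).map (S.J (f x)).toLinearMap) ↔
        D.inducedConnection nabla W U x ∈ D.screen x := by
    have hJ : covAlong nabla f (fun x' ↦ S.J (f x') (D.push U x')) x (W x) =
        S.J (f x) (covAlong nabla f (D.push U) x (W x)) :=
      covAlong_parallel S hS ((hf x).mdifferentiableAt (by simp))
        (mdifferentiableAt_mfderiv_apply hf hU.contMDiff x) (W x)
    unfold LightlikeSubmanifold.nablaS LightlikeSubmanifold.hs
      LightlikeSubmanifold.inducedConnection
    rw [hJ]
    exact D.hasNoComponentIn_iff S hltr _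
  refine ⟨fun h W U hW hU x ↦ (key W U hU x).2 (h.totallyGeodesic W U hW hU x), fun h ↦ ?_⟩
  have hgeod (W U : Π x : N, TangentSpace 𝓘(ℝ, E') x) (hW : D.IsScreenSection W)
      (hU : D.IsScreenSection U) (x : N) : D.inducedConnection nabla W U x ∈ D.screen x :=
    (key W U hU x).1 (h W U hW hU x)
  refine ⟨fun W U hW hU x ↦ ?_, hgeod⟩
  have htorsion := covAlong_mfderiv_sub hnabla.torsion_eq_zero hf
    ((hW.contMDiff x).mdifferentiableAt (by simp)) ((hU.contMDiff x).mdifferentiableAt (by simp))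
  -- Taking `TN`-components of the torsion identity gives `[W, U] = ∇_W U - ∇_U W`.
  rw [← D.tangentPart_mfderiv (VectorField.mlieBracket 𝓘(ℝ, E') W U x), ← htorsion,
    D.tangentPart_sub]
  exact sub_mem (hgeod W U hW hU x) (hgeod U W hU hW x)
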